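/- Let $(X_1,X_2,\ldots)$ be an infinite exchangeable sequence of real-valued random variables, that is, the law of the sequence is invariant under every permutation of the indices that moves only finitely many of them. Let $K_3:=\#\{X_1,X_2,X_3\}$ be the number of distinct values among the first three terms. Then $$\mathbb{P}(K_3=2)\le\frac34.$$ -/

import Mathlib

open MeasureTheory

/-- The sequence `X 0, X 1, …` is exchangeable under `μ`: the law of the whole sequence is invariant
under every permutation of the indices that moves only finitely many of them. -/
def Exchangeable {Ω : Type*} [MeasurableSpace Ω] (μ : Measure Ω) (X : ℕ → Ω → ℝ) : Prop :=
  ∀ σ : Equiv.Perm ℕ, {i | σ i ≠ i}.Finite →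
    μ.map (fun ω (i : ℕ) => X (σ i) ω) = μ.map (fun ω (i : ℕ) => X i ω)

/-- The number of distinct values among the first `n` terms `X 0 ω, …, X (n - 1) ω`. -/
noncomputable def numDistinct {Ω : Type*} (X : ℕ → Ω → ℝ) (n : ℕ) (ω : Ω) : ℕ :=
  ((Finset.range n).image (fun i => X i ω)).card

/-! The event `K₃ = 2` splits into three events "two given terms agree, the third differs", all of
the same probability `q` by exchangeability; so `q ≤ 1/4` suffices. If `m` of the terms `X 1, …, X
n` equal `X 0`, then `m (n - m) ≤ n² / 4` ordered pairs `(i, j)` satisfy `X 0 = X i ≠ X j`. Taking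
expectations gives `n (n - 1) q ≤ n² / 4`, and large `n` forces `q ≤ 1/4`. -/

/-- Three distinct indices are the images of `0, 1, 2` under a finitely supported permutation. -/
theorem exists_perm_finite_support {i j k : ℕ} (hij : i ≠ j) (hik : i ≠ k) (hjk : j ≠ k) :
    ∃ σ : Equiv.Perm ℕ, {m | σ m ≠ m}.Finite ∧ σ 0 = i ∧ σ 1 = j ∧ σ 2 = k := by
  have hs : ∀ a b : ℕ, {m | Equiv.swap a b m ≠ m}.Finite := fun a b =>
    (Set.toFinite {a, b}).subset fun m hm => by
      by_contra h
      simp only [Set.mem_insert_iff, Set.mem_singleton_iff, not_or] at h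
      exact hm (Equiv.swap_apply_of_ne_of_ne h.1 h.2)
  have hmul : ∀ σ τ : Equiv.Perm ℕ, {m | σ m ≠ m}.Finite → {m | τ m ≠ m}.Finite →
      {m | (σ * τ) m ≠ m}.Finite := fun σ τ h₁ h₂ =>
    (h₁.union h₂).subset (Equiv.Perm.set_support_mul_subset σ τ)
  set σ := Equiv.swap 0 i with hσ
  set τ := Equiv.swap (σ 1) j * σ with hτ
  have σ0 : σ 0 = i := Equiv.swap_apply_left _ _
  have σ1 : σ 1 ≠ i := by rw [← σ0]; exact fun h => by simpa using σ.injective h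
  have τ0 : τ 0 = i := by
    rw [hτ, Equiv.Perm.mul_apply, σ0, Equiv.swap_apply_of_ne_of_ne σ1.symm hij]
  have τ1 : τ 1 = j := by rw [hτ, Equiv.Perm.mul_apply, Equiv.swap_apply_left]
  have τ20 : τ 2 ≠ i := by rw [← τ0]; exact fun h => by simpa using τ.injective h
  have τ21 : τ 2 ≠ j := by rw [← τ1]; exact fun h => by simpa using τ.injective h
  refine ⟨Equiv.swap (τ 2) k * τ, hmul _ _ (hs _ _) (hmul _ _ (hs _ _) (hs _ _)), ?_, ?_, ?_⟩
  · rw [Equiv.Perm.mul_apply, τ0, Equiv.swap_apply_of_ne_of_ne τ20.symm hik]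
  · rw [Equiv.Perm.mul_apply, τ1, Equiv.swap_apply_of_ne_of_ne τ21.symm hjk]
  · rw [Equiv.Perm.mul_apply, Equiv.swap_apply_left]

theorem sum_indicator_eq_and_ne_le {Ω : Type*} {X : ℕ → Ω → ℝ} (n : ℕ) (ω : Ω) :
    ∑ i ∈ Finset.range n, ∑ j ∈ Finset.range n,
      {ω | X 0 ω = X (i + 1) ω ∧ X 0 ω ≠ X (j + 1) ω}.indicator (fun _ => (1 : ℝ)) ω
        ≤ (n : ℝ) ^ 2 / 4 := by
  classical
  set y : ℕ → ℝ := fun i => if X 0 ω = X (i + 1) ω then 1 else 0 with hy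
  have h : ∀ i j : ℕ,
      {ω | X 0 ω = X (i + 1) ω ∧ X 0 ω ≠ X (j + 1) ω}.indicator (fun _ => (1 : ℝ)) ω
        = y i * (1 - y j) := by
    intro i j
    simp only [Set.indicator_apply, Set.mem_ofPred_eq, hy]
    split_ifs <;> simp_all
  simp_rw [h, ← Finset.mul_sum, ← Finset.sum_mul, Finset.sum_sub_distrib, Finset.sum_const,
    Finset.card_range, nsmul_eq_mul, mul_one]
  -- With `m = ∑ y i`, the double sum factors as `m (n - m)`, and `(2m - n)² ≥ 0` bounds it.
  nlinarith [sq_nonneg (2 * ∑ i ∈ Finset.range n, y i - n)]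

section

variable {Ω : Type*} [MeasurableSpace Ω] {μ : Measure Ω} {X : ℕ → Ω → ℝ}

theorem measurableSet_eq_and_ne (hX : ∀ i, Measurable (X i)) (i j k : ℕ) :
    MeasurableSet {ω | X i ω = X j ω ∧ X i ω ≠ X k ω} :=
  (measurableSet_eq_fun (hX i) (hX j)).inter (measurableSet_eq_fun (hX i) (hX k)).compl

theorem Exchangeable.measureReal_eq_and_ne (hexch : Exchangeable μ X)
    (hX : ∀ i, Measurable (X i)) {i j k : ℕ} (hij : i ≠ j) (hik : i ≠ k) (hjk : j ≠ k) :
    μ.real {ω | X i ω = X j ω ∧ X i ω ≠ X k ω} = μ.real {ω | X 0 ω = X 1 ω ∧ X 0 ω ≠ X 2 ω} := by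
  obtain ⟨σ, hσ, rfl, rfl, rfl⟩ := exists_perm_finite_support hij hik hjk
  have hB : MeasurableSet {x : ℕ → ℝ | x 0 = x 1 ∧ x 0 ≠ x 2} :=
    measurableSet_eq_and_ne (X := fun i (x : ℕ → ℝ) => x i) measurable_pi_apply 0 1 2
  have h := congrArg (fun ν : Measure (ℕ → ℝ) => ν.real {x | x 0 = x 1 ∧ x 0 ≠ x 2}) (hexch σ hσ)
  rwa [map_measureReal_apply (measurable_pi_lambda _ fun i => hX (σ i)) hB,
    map_measureReal_apply (measurable_pi_lambda _ hX) hB] at h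

theorem Exchangeable.mul_measureReal_le [IsProbabilityMeasure μ] (hexch : Exchangeable μ X)
    (hX : ∀ i, Measurable (X i)) (n : ℕ) :
    (n : ℝ) * (n - 1) * μ.real {ω | X 0 ω = X 1 ω ∧ X 0 ω ≠ X 2 ω} ≤ (n : ℝ) ^ 2 / 4 := by
  set q := μ.real {ω | X 0 ω = X 1 ω ∧ X 0 ω ≠ X 2 ω} with hq
  have hint : ∀ i j : ℕ, Integrable
      ({ω | X 0 ω = X (i + 1) ω ∧ X 0 ω ≠ X (j + 1) ω}.indicator fun _ => (1 : ℝ)) μ :=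
    fun i j => (integrable_const 1).indicator (measurableSet_eq_and_ne hX 0 (i + 1) (j + 1))
  have hval : ∀ i j : ℕ, ∫ ω, {ω | X 0 ω = X (i + 1) ω ∧ X 0 ω ≠ X (j + 1) ω}.indicator
      -- The diagonal event `i = j` is contradictory, hence `n (n - 1)` rather than `n²` copies of
      -- `q`.
      (fun _ => (1 : ℝ)) ω ∂μ = q - if i = j then q else 0 := by
    intro i j
    rw [integral_indicator_const _ (measurableSet_eq_and_ne hX 0 (i + 1) (j + 1)), smul_eq_mul,
      mul_one]
    by_cases hij : i = j
    · subst hij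
      simp
    · rw [hexch.measureReal_eq_and_ne hX (by omega) (by omega) (by omega), if_neg hij, sub_zero]
  have hle : ∫ ω, ∑ i ∈ Finset.range n, ∑ j ∈ Finset.range n,
      {ω | X 0 ω = X (i + 1) ω ∧ X 0 ω ≠ X (j + 1) ω}.indicator (fun _ => (1 : ℝ)) ω ∂μ
        ≤ ∫ _, (n : ℝ) ^ 2 / 4 ∂μ :=
    integral_mono
      (integrable_finsetSum _ fun i _ => integrable_finsetSum _ fun j _ => hint i j)
      (integrable_const _) fun ω => sum_indicator_eq_and_ne_le n ω
  rw [integral_finsetSum _ fun i _ => integrable_finsetSum _ fun j _ => hint i j] at hle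
  simp_rw [integral_finsetSum _ fun j _ => hint _ j, hval, Finset.sum_sub_distrib,
    Finset.sum_ite_eq] at hle
  rw [Finset.sum_congr rfl fun i hi => if_pos hi] at hle
  simp only [Finset.sum_const, Finset.card_range, nsmul_eq_mul, integral_const,
    probReal_univ, smul_eq_mul, one_mul] at hle
  linarith

theorem Exchangeable.measureReal_le_quarter [IsProbabilityMeasure μ] (hexch : Exchangeable μ X)
    (hX : ∀ i, Measurable (X i)) :
    μ.real {ω | X 0 ω = X 1 ω ∧ X 0 ω ≠ X 2 ω} ≤ 1 / 4 := by
  set q := μ.real {ω | X 0 ω = X 1 ω ∧ X 0 ω ≠ X 2 ω} with hq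
  by_contra! hlt
  -- This threshold is where `(n - 1) q > n / 4` begins.
  obtain ⟨n, hn⟩ := exists_nat_gt (4 * q / (4 * q - 1))
  have hpos : 0 < 4 * q - 1 := by linarith
  have hn0 : (0 : ℝ) < n := lt_trans (div_pos (by linarith) hpos) hn
  rw [div_lt_iff₀ hpos] at hn
  have h := hexch.mul_measureReal_le hX n
  have h' : (n : ℝ) * ((n - 1) * q) ≤ n * (n / 4) := by rw [← hq] at h; linarith
  linarith [le_of_mul_le_mul_left h' hn0]

end

theorem numDistinct_three_eq_two {Ω : Type*} {X : ℕ → Ω → ℝ} {ω : Ω}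
    (h : numDistinct X 3 ω = 2) :
    (X 0 ω = X 1 ω ∧ X 0 ω ≠ X 2 ω) ∨ (X 0 ω = X 2 ω ∧ X 0 ω ≠ X 1 ω) ∨
      (X 1 ω = X 2 ω ∧ X 1 ω ≠ X 0 ω) := by
  have hr : Finset.range 3 = {0, 1, 2} := rfl
  rw [numDistinct, hr] at h
  by_cases h₁ : X 0 ω = X 1 ω <;> by_cases h₂ : X 0 ω = X 2 ω <;>
    by_cases h₃ : X 1 ω = X 2 ω <;> simp_all [eq_comm]

theorem proposition1 {Ω : Type*} [MeasurableSpace Ω] (μ : Measure Ω) [IsProbabilityMeasure μ]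
    (X : ℕ → Ω → ℝ) (hX : ∀ i, Measurable (X i)) (hexch : Exchangeable μ X) :
    μ.real {ω | numDistinct X 3 ω = 2} ≤ 3 / 4 := by
  have hsub : {ω | numDistinct X 3 ω = 2} ⊆ {ω | X 0 ω = X 1 ω ∧ X 0 ω ≠ X 2 ω} ∪
      ({ω | X 0 ω = X 2 ω ∧ X 0 ω ≠ X 1 ω} ∪ {ω | X 1 ω = X 2 ω ∧ X 1 ω ≠ X 0 ω}) :=
    fun _ h => numDistinct_three_eq_two h
  have h₁ := hexch.measureReal_eq_and_ne hX (i := 0) (j := 2) (k := 1)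
    (by omega) (by omega) (by omega)
  have h₂ := hexch.measureReal_eq_and_ne hX (i := 1) (j := 2) (k := 0)
    (by omega) (by omega) (by omega)
  refine (measureReal_mono hsub).trans ((measureReal_union_le _ _).trans ?_)
  linarith [hexch.measureReal_le_quarter hX,
    measureReal_union_le (μ := μ) {ω | X 0 ω = X 2 ω ∧ X 0 ω ≠ X 1 ω}
      {ω | X 1 ω = X 2 ω ∧ X 1 ω ≠ X 0 ω}]
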